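/- Let $f,\omega\in\mathbb C[x]$. Let $C\subset\mathbb C$ be the set of critical values of $f$, and for $t\in\mathbb C$ let $L_t=f^{-1}(t)$ and $H_0(L_t,\mathbb Z)=\{\sum_i n_i x_i : x_i\in L_t,\ n_i\in\mathbb Z,\ \sum_i n_i=0\}$ be the reduced homology of the fibre. A simple cycle is an element $x-y\in H_0(L_t,\mathbb Z)$ with $x\neq y$ in $L_t$, and for $\gamma=\sum_i n_i x_i$ one writes $\int_\gamma\omega=\sum_i n_i\,\omega(x_i)$. Let $D\subset\mathbb C\setminus C$ be a connected set with more than one point (for instance a simply connected domain, or a nondegenerate real interval), and let $\gamma(t)=x(t)-y(t)$, $t\in D$, be a continuous family of simple cycles in the fibres of $f$, that is, $x,y:D\to\mathbb C$ are continuous, $f(x(t))=f(y(t))=t$ and $x(t)\ne y(t)$ for all $t\in D$. If $I(t)=\int_{\gamma(t)}\omega$ vanishes identically on $D$, then there is a nonzero polynomial $g(x,t)\in\mathbb C[t][x]$ such that 1. $\deg_x(g)\mid\deg(f)$ and $\deg_x(g)<\deg(f)$; 2. $g(\omega(x),f(x))\equiv 0$; 3. if for some regular value $b\in\mathbb C\setminus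 C$ the monodromy group of $f$ (the image of $\pi_1(\mathbb C\setminus C,b)$ in the group of permutations of $L_b$) acts transitively on the set of simple cycles of $H_0(L_b,\mathbb Z)$, then $\omega=p(f)$ for some $p\in\mathbb C[x]$. -/

import Mathlib

open Polynomial

/-- The set of critical values of the polynomial map `f : ℂ → ℂ`. -/
def criticalValues (f : ℂ[X]) : Set ℂ :=
  (fun x => f.eval x) '' {x | f.derivative.eval x = 0}

/-- The set of regular values of `f`, the complement of the set of critical values. -/
def regularValues (f : ℂ[X]) : Set ℂ := (criticalValues f)ᶜ

/-- The fibre `L_t = f⁻¹(t)`. -/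
abbrev Fiber (f : ℂ[X]) (t : ℂ) : Type := {x : ℂ // f.eval x = t}

/-- The reduced homology group `H₀(M, ℤ)` of a discrete space `M`: the finite formal sums
`∑ nᵢ xᵢ` with integer coefficients and `∑ nᵢ = 0`. -/
noncomputable def ReducedH0 (M : Type) : AddSubgroup (M →₀ ℤ) :=
  (Finsupp.degree : (M →₀ ℤ) →+ ℤ).ker

/-- The cycle `x - y`. -/
noncomputable def pointDiff {M : Type} (x y : M) : ReducedH0 M :=
  ⟨Finsupp.single x 1 - Finsupp.single y 1, by
    simp [ReducedH0, AddMonoidHom.mem_ker, Finsupp.degree_single]⟩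

/-- The simple cycles: the cycles `x - y` with `x ≠ y`. -/
def simpleCycles (M : Type) : Set (ReducedH0 M) :=
  {γ | ∃ x y : M, x ≠ y ∧ γ = pointDiff x y}

/-- The action of a permutation of `M` on `H₀(M, ℤ)`: `σ (∑ nᵢ xᵢ) = ∑ nᵢ σ(xᵢ)`. -/
noncomputable def permCycle {M : Type} (σ : Equiv.Perm M) (γ : ReducedH0 M) : ReducedH0 M :=
  ⟨Finsupp.equivMapDomain σ γ.1, by
    have h : Finsupp.degree γ.1 = 0 := γ.2
    show Finsupp.degree (Finsupp.equivMapDomain σ γ.1) = 0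
    rw [← h, Finsupp.degree_apply, Finsupp.degree_apply]
    simp [Finsupp.equivMapDomain]⟩

/-- The integral of the `0`-form `ω` over the cycle `γ = ∑ nᵢ xᵢ` in a fibre of `f`, that is
`∑ nᵢ ω(xᵢ)`. -/
noncomputable def cycleIntegral {f : ℂ[X]} {t : ℂ} (ω : ℂ[X]) (γ : ReducedH0 (Fiber f t)) : ℂ :=
  γ.1.sum fun x n => (n : ℂ) * ω.eval (x : ℂ)

/-- `γ` restricts to a continuous family of simple cycles `γ(t) = x(t) - y(t)`, `t ∈ D`, in the
fibres of `f` (the values of `γ` outside `D` play no role). -/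
def IsContinuousSimpleFamily (f : ℂ[X]) (D : Set ℂ) (γ : ∀ t : ℂ, ReducedH0 (Fiber f t)) : Prop :=
  ∃ x y : ℂ → ℂ, ContinuousOn x D ∧ ContinuousOn y D ∧
    ∀ t ∈ D, ∃ (hx : f.eval (x t) = t) (hy : f.eval (y t) = t),
      x t ≠ y t ∧ γ t = pointDiff ⟨x t, hx⟩ ⟨y t, hy⟩

/-- Over the regular values, `f` is a covering map. -/
theorem isCoveringMap_regular (f : ℂ[X]) :
    IsCoveringMap ((regularValues f).restrictPreimage fun x => f.eval x) :=
  f.isCoveringMapOn_eval.isCoveringMap_restrictPreimage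

/-- The fibre of the covering over a regular value `b` is the fibre `f⁻¹(b)`. -/
def fiberEquiv (f : ℂ[X]) (b : regularValues f) :
    ((regularValues f).restrictPreimage fun x => f.eval x) ⁻¹' {b} ≃ Fiber f b where
  toFun e := ⟨e.1.1, congrArg Subtype.val e.2⟩
  invFun x := ⟨⟨x.1, by rw [Set.mem_preimage, x.2]; exact b.2⟩, Subtype.ext x.2⟩
  left_inv _ := rfl
  right_inv _ := rfl

/-- The action of the fundamental group `π₁(ℂ ∖ C, b)` on the fibre `f⁻¹(b)` over a regular
value `b`, where `C` is the set of critical values. -/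
noncomputable def monodromyHom (f : ℂ[X]) (b : regularValues f) :
    FundamentalGroup (regularValues f) b →* Equiv.Perm (Fiber f b) :=
  (fiberEquiv f b).permCongrHom.toMonoidHom.comp ((isCoveringMap_regular f).monodromyPerm b)

/-- The monodromy group of `f` at the regular value `b`, as a group of permutations of
`f⁻¹(b)`. -/
noncomputable def monodromyGroup (f : ℂ[X]) (b : regularValues f) :
    Subgroup (Equiv.Perm (Fiber f b)) :=
  (monodromyHom f b).range

/-- The monodromy group acts transitively on the simple cycles of `H₀(f⁻¹(b), ℤ)`: they form a
single orbit. -/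
def MonodromyIrreducible (f : ℂ[X]) (b : regularValues f) : Prop :=
  ∀ γ₁ ∈ simpleCycles (Fiber f b), ∀ γ₂ ∈ simpleCycles (Fiber f b),
    ∃ σ ∈ monodromyGroup f b, permCycle σ γ₁ = γ₂

open Filter Topology

/-! Since [ℂ(x) : ℂ(f)] = deg f, the minimal polynomial of ω over ℂ(f) has degree dividing deg f.
Cleared of denominators it serves as g, unless ω generates ℂ(x). In that case h(f)·x = A(ω, f) with
h ≠ 0, so ω separates the points of L_t whenever h(t) ≠ 0, contradicting ω(x(t)) = ω(y(t)) on the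
infinite set D.

For the last claim, D accumulates at each of its points, so the identity theorem makes ω agree on
all common-fibre pairs near (x(t), y(t)). This agreement survives lifting of paths
(`locallyAgree_monodromy_iff`), hence by transitivity holds for all pairs in L_b, then in every
regular fibre. Division by f - b turns such an ω into a polynomial in f. -/

/-! ### The field extension ℂ(x)/ℂ(f) -/

theorem exists_map_eq_mul_map_of_adjoin_simple {F E : Type*} [Field F] [Field E] [Algebra F E]
    (α : E) (q : (IntermediateField.adjoin F {α})[X]) :
    ∃ (h : F[X]) (Q : F[X][X]), h ≠ 0 ∧
      Q.map (aeval α : F[X] →ₐ[F] E).toRingHom =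
        C (aeval α h) * q.map (algebraMap (IntermediateField.adjoin F {α}) E) := by
  induction q using Polynomial.induction_on' with
  | add p q hp hq =>
    obtain ⟨h₁, Q₁, hh₁, e₁⟩ := hp
    obtain ⟨h₂, Q₂, hh₂, e₂⟩ := hq
    refine ⟨h₁ * h₂, C h₂ * Q₁ + C h₁ * Q₂, mul_ne_zero hh₁ hh₂, ?_⟩
    simp only [Polynomial.map_add, Polynomial.map_mul, Polynomial.map_C, e₁, e₂, map_mul]
    simp only [AlgHom.toRingHom_eq_coe, RingHom.coe_coe]
    ring
  | monomial n a =>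
    obtain ⟨r, s, hrs⟩ := IntermediateField.mem_adjoin_simple_iff F (a : E) |>.1 a.2
    by_cases hs : aeval α s = 0
    -- Here the coefficient is r(α)/0, which is 0 by convention.
    · refine ⟨1, 0, one_ne_zero, ?_⟩
      simp only [hs, div_zero] at hrs
      simp [hrs]
    · refine ⟨s, monomial n r, fun h => hs (by simp [h]), ?_⟩
      simp only [Polynomial.map_monomial, IntermediateField.algebraMap_apply, hrs,
        Polynomial.C_mul_monomial, mul_div_cancel₀ _ hs]
      rfl

/-- The minimal polynomial of `ω` over `ℂ(f)`, with denominators cleared. If it has full degree,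
then `x` is a rational expression in `ω` and `f`. -/
theorem exists_annihilator_or_generator {f : ℂ[X]} (hf : 0 < f.natDegree) (ω : ℂ[X]) :
    (∃ g : ℂ[X][X], g ≠ 0 ∧ g.natDegree ∣ f.natDegree ∧ g.natDegree < f.natDegree ∧
      g.eval₂ (compRingHom f) ω = 0) ∨
    ∃ (h : ℂ[X]) (A : ℂ[X][X]), h ≠ 0 ∧ A.eval₂ (compRingHom f) ω = h.comp f * X := by
  set α : RatFunc ℂ := algebraMap ℂ[X] (RatFunc ℂ) f with hα
  set y : RatFunc ℂ := algebraMap ℂ[X] (RatFunc ℂ) ω with hy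
  have hnc : ¬ ∃ c, α = RatFunc.C c := by
    rintro ⟨c, hc⟩
    rw [hα, ← RatFunc.algebraMap_C] at hc
    rw [RatFunc.algebraMap_injective ℂ hc] at hf
    simp at hf
  have htr : Transcendental ℂ α := RatFunc.transcendental_of_ne_C α hnc
  have hfin : Module.finrank (IntermediateField.adjoin ℂ {α}) (RatFunc ℂ) = f.natDegree := by
    rw [RatFunc.finrank_eq_max_natDegree, hα, RatFunc.num_algebraMap, RatFunc.denom_algebraMap]
    simp
  have : FiniteDimensional (IntermediateField.adjoin ℂ {α}) (RatFunc ℂ) :=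
    Module.finite_of_finrank_pos (by omega)
  have hα' : ∀ p : ℂ[X], aeval α p = algebraMap ℂ[X] (RatFunc ℂ) (p.comp f) := by
    intro p
    rw [hα, aeval_algebraMap_apply, comp_eq_aeval]
  have hhom : (aeval α : ℂ[X] →ₐ[ℂ] RatFunc ℂ).toRingHom =
      (algebraMap ℂ[X] (RatFunc ℂ)).comp (compRingHom f) := by
    refine RingHom.ext fun p => ?_
    exact hα' p
  have hinj : Function.Injective (aeval α : ℂ[X] →ₐ[ℂ] RatFunc ℂ).toRingHom :=
    transcendental_iff_injective.1 htr
  have key : ∀ q : (IntermediateField.adjoin ℂ {α})[X], ∃ (h : ℂ[X]) (Q : ℂ[X][X]), h ≠ 0 ∧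
      Q.natDegree = q.natDegree ∧ (Q = 0 → q = 0) ∧
      algebraMap ℂ[X] (RatFunc ℂ) (Q.eval₂ (compRingHom f) ω) =
        algebraMap ℂ[X] (RatFunc ℂ) (h.comp f) * aeval y q := by
    intro q
    obtain ⟨h, Q, hh, e⟩ := exists_map_eq_mul_map_of_adjoin_simple α q
    have hh' : aeval α h ≠ 0 := fun h0 => hh (hinj (by simpa using h0))
    refine ⟨h, Q, hh, ?_, ?_, ?_⟩
    · rw [← natDegree_map_eq_of_injective hinj, e, natDegree_C_mul hh', natDegree_map]
    · rintro rfl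
      simpa [hh'] using e.symm
    · rw [hom_eval₂, ← hhom, ← eval_map, e, ← hα']
      rw [eval_mul, eval_C, eval_map, aeval_def y]
  by_cases hd : (minpoly (IntermediateField.adjoin ℂ {α}) y).natDegree = f.natDegree
  · right
    have htop := (Field.primitive_element_iff_minpoly_natDegree_eq _ y).2 (hd.trans hfin.symm)
    have hX : RatFunc.X ∈ (IntermediateField.adjoin (IntermediateField.adjoin ℂ {α}) {y}) :=
      htop ▸ IntermediateField.mem_top
    rw [← IntermediateField.mem_toSubalgebra,
      IntermediateField.adjoin_simple_toSubalgebra_of_isAlgebraic (IsAlgebraic.of_finite _ y),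
      Algebra.adjoin_singleton_eq_range_aeval] at hX
    obtain ⟨q, hq⟩ := hX
    obtain ⟨h, Q, hh, -, -, e⟩ := key q
    refine ⟨h, Q, hh, RatFunc.algebraMap_injective ℂ ?_⟩
    rw [e, map_mul, RatFunc.algebraMap_X]
    exact congrArg _ hq
  · left
    obtain ⟨h, Q, hh, hdeg, h0, e⟩ := key (minpoly (IntermediateField.adjoin ℂ {α}) y)
    have hdvd : Q.natDegree ∣ f.natDegree := by
      rw [hdeg, ← hfin]
      exact minpoly.degree_dvd (IsIntegral.of_finite _ y)
    refine ⟨Q, fun hQ => minpoly.ne_zero (IsIntegral.of_finite _ y) (h0 hQ), hdvd,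
      lt_of_le_of_ne (Nat.le_of_dvd hf hdvd) (hdeg ▸ hd), RatFunc.algebraMap_injective ℂ ?_⟩
    rw [e, minpoly.aeval, mul_zero, map_zero]

/-! ### Polynomials constant on fibres -/

theorem finite_criticalValues {f : ℂ[X]} (hf : 0 < f.natDegree) : (criticalValues f).Finite := by
  refine Set.Finite.image _ ?_
  have h0 : f.derivative ≠ 0 := fun h => hf.ne' (derivative_eq_zero.1 h)
  exact (f.derivative.rootSet_finite ℂ).subset fun x hx => by
    rw [mem_rootSet]; exact ⟨h0, by simpa using hx⟩

theorem card_roots_toFinset_of_regular {f : ℂ[X]} (hf : 0 < f.natDegree) {b : ℂ}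
    (hb : b ∈ regularValues f) : (f - C b).roots.toFinset.card = f.natDegree := by
  have h0 : f - C b ≠ 0 := fun h => by
    rw [sub_eq_zero.1 h, natDegree_C] at hf; exact hf.ne rfl
  have hnd : (f - C b).roots.Nodup := by
    rw [Multiset.nodup_iff_count_le_one]
    intro a
    rw [count_roots]
    by_contra! hlt
    rw [one_lt_rootMultiplicity_iff_isRoot h0] at hlt
    refine hb ⟨a, ?_, ?_⟩
    · simpa using hlt.2
    · simpa [sub_eq_zero] using hlt.1
  rw [Multiset.toFinset_card_of_nodup hnd, ← (IsAlgClosed.splits (f - C b)).natDegree_eq_card_roots,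
    natDegree_sub_C]

/-- A polynomial constant on almost all fibres of `f` is a polynomial in `f`. -/
theorem exists_eq_comp_of_constant_on_fibers {f : ℂ[X]} (hf : 0 < f.natDegree) (ω : ℂ[X])
    (T : Set ℂ) (hT : T.Finite)
    (h : ∀ x y, f.eval x = f.eval y → f.eval x ∉ T → ω.eval x = ω.eval y) :
    ∃ p : ℂ[X], ω = p.comp f := by
  induction hn : ω.natDegree using Nat.strong_induction_on generalizing ω T with
  | _ n ih =>
  subst hn
  obtain ⟨b, hb⟩ := (hT.union (finite_criticalValues hf)).infinite_compl.nonempty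
  rw [Set.compl_union] at hb
  have hcard := card_roots_toFinset_of_regular hf (b := b) hb.2
  set F := f - C b with hF
  have hdF : F.natDegree = f.natDegree := natDegree_sub_C
  have hF0 : F ≠ 0 := fun h0 => by rw [h0, natDegree_zero] at hdF; omega
  obtain ⟨x₀, hx₀⟩ : F.roots.toFinset.Nonempty := by
    rw [← Finset.card_pos, hcard]; exact hf
  have hroot : ∀ x ∈ F.roots.toFinset, f.eval x = b := fun x hx => by
    rw [Multiset.mem_toFinset, mem_roots hF0] at hx
    simpa [hF, sub_eq_zero] using hx
  have hdiv : F * (ω / F) + ω % F = ω := EuclideanDomain.div_add_mod ω F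
  -- The remainder has degree below deg f but takes one value at the deg f points of L_b.
  have hr : ω % F = C (ω.eval x₀) := by
    rw [← sub_eq_zero]
    refine eq_zero_of_natDegree_lt_card_of_eval_eq_zero' _ F.roots.toFinset ?_ ?_
    · intro x hx
      have e := congrArg (eval x) hdiv
      have hFx : F.eval x = 0 := by simp [hF, hroot x hx]
      rw [eval_add, eval_mul, hFx, zero_mul, zero_add] at e
      rw [eval_sub, e, eval_C, sub_eq_zero]
      exact h _ _ ((hroot x hx).trans (hroot x₀ hx₀).symm) (hroot x hx ▸ hb.1)
    · rw [natDegree_sub_C, hcard, ← hdF]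
      exact natDegree_mod_lt ω (by omega)
  rw [hr] at hdiv
  obtain ⟨p, hp⟩ : ∃ p : ℂ[X], ω / F = p.comp f := by
    by_cases hq : ω / F = 0
    · exact ⟨0, by rw [hq, zero_comp]⟩
    -- Constancy passes to the quotient only where f - b ≠ 0, so b joins the exceptional set.
    · refine ih _ ?_ (ω / F) (T ∪ {b}) (hT.union (Set.finite_singleton b)) ?_ rfl
      · have e := congrArg natDegree hdiv
        rw [natDegree_add_C, natDegree_mul hF0 hq] at e
        omega
      · intro x y hxy hx
        rw [Set.mem_union, not_or] at hx
        have hne : F.eval x ≠ 0 := by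
          rw [hF, eval_sub, eval_C, sub_ne_zero]; exact hx.2
        have e : F.eval x = F.eval y := by rw [hF, eval_sub, eval_sub, hxy]; simp
        have e₁ := congrArg (eval x) hdiv
        have e₂ := congrArg (eval y) hdiv
        have e₃ := h x y hxy hx.1
        simp only [eval_add, eval_mul, eval_C] at e₁ e₂
        rw [← e] at e₂
        exact mul_left_cancel₀ hne (by linear_combination e₁ - e₂ + e₃)
  refine ⟨(X - C b) * p + C (ω.eval x₀), ?_⟩
  rw [hp] at hdiv
  simp only [add_comp, mul_comp, sub_comp, X_comp, C_comp]
  exact hdiv.symm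

/-! ### Analytic continuation of agreement -/

/-- `ω` takes equal values at the two points of every pair close to `p` that lies in a common
fibre of `f`. -/
def LocallyAgree (f ω : ℂ[X]) (p : ℂ × ℂ) : Prop :=
  ∀ᶠ q in 𝓝 p, f.eval q.1 = f.eval q.2 → ω.eval q.1 = ω.eval q.2

theorem LocallyAgree.eval_eq {f ω : ℂ[X]} {p : ℂ × ℂ} (h : LocallyAgree f ω p)
    (hp : f.eval p.1 = f.eval p.2) : ω.eval p.1 = ω.eval p.2 :=
  h.self_of_nhds hp

/-- Near p = (x, y), common-fibre pairs lie on the graph of s ∘ f, with s the local inverse of f at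
y. The difference of ω is then analytic in one variable, and its zeros are isolated or fill a
neighbourhood. -/
theorem locallyAgree_or_eventually_ne (f ω : ℂ[X]) {p : ℂ × ℂ} (hp : f.eval p.1 = f.eval p.2)
    (hd : f.derivative.eval p.2 ≠ 0) :
    LocallyAgree f ω p ∨ ∀ᶠ q in 𝓝[≠] p, f.eval q.1 = f.eval q.2 → ω.eval q.1 ≠ ω.eval q.2 := by
  obtain ⟨x, y⟩ := p
  dsimp only at hp hd
  have han : ∀ (g : ℂ[X]) (z : ℂ), AnalyticAt ℂ (fun u => g.eval u) z := fun g z =>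
    AnalyticAt.aeval_polynomial analyticAt_id g
  have hd' : deriv (fun u => f.eval u) y ≠ 0 := by rwa [Polynomial.deriv]
  set s := (han f y).hasStrictDerivAt.localInverse _ _ _ hd' with hs
  have hsan : AnalyticAt ℂ s (f.eval x) := hp ▸ (han f y).analyticAt_localInverse hd'
  have hsl : ∀ᶠ v in 𝓝 y, s (f.eval v) = v :=
    (han f y).hasStrictDerivAt.eventually_left_inverse hd'
  have hφ : AnalyticAt ℂ (fun u => ω.eval u - ω.eval (s (f.eval u))) x :=
    (han ω x).sub (AnalyticAt.fun_comp (han ω _) (AnalyticAt.fun_comp hsan (han f x)))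
  have hgraph : ∀ᶠ q : ℂ × ℂ in 𝓝 (x, y), f.eval q.1 = f.eval q.2 → q.2 = s (f.eval q.1) := by
    filter_upwards [(continuous_snd.tendsto (x, y)).eventually hsl] with q hq he
    rw [he, hq]
  rcases hφ.eventually_eq_zero_or_eventually_ne_zero with h | h
  · left
    filter_upwards [(continuous_fst.tendsto (x, y)).eventually h, hgraph] with q hq hg he
    rw [hg he]
    exact sub_eq_zero.1 hq
  · right
    rw [eventually_nhdsWithin_iff] at h ⊢
    filter_upwards [(continuous_fst.tendsto (x, y)).eventually h, hgraph] with q hq hg hne he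
    rw [hg he]
    refine sub_ne_zero.1 (hq fun hx => hne ?_)
    have hx : q.1 = x := hx
    refine Prod.ext hx ?_
    rw [hg he, hx, hp]
    exact hsl.self_of_nhds

/-- Along connected families of pairs of points in common fibres, `LocallyAgree` is constant. -/
theorem LocallyAgree.of_isPreconnected {f ω : ℂ[X]} {T : Set (ℂ × ℂ)} (hT : IsPreconnected T)
    (hTf : ∀ p ∈ T, f.eval p.1 = f.eval p.2) (hTd : ∀ p ∈ T, f.derivative.eval p.2 ≠ 0)
    {p q : ℂ × ℂ} (hp : p ∈ T) (hq : q ∈ T) (h : LocallyAgree f ω p) : LocallyAgree f ω q := by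
  by_contra hnq
  have hV : ∀ r ∈ T, ¬ LocallyAgree f ω r →
      ∀ᶠ r' in 𝓝 r, f.eval r'.1 = f.eval r'.2 → ¬ LocallyAgree f ω r' := by
    intro r hr hnr
    have hne := (locallyAgree_or_eventually_ne f ω (hTf r hr) (hTd r hr)).resolve_left hnr
    rw [eventually_nhdsWithin_iff] at hne
    filter_upwards [hne] with r' hr' he ha
    by_cases hrr : r' = r
    · exact hnr (hrr ▸ ha)
    · exact hr' hrr he (ha.eval_eq he)
  -- Pairs off a common fibre agree vacuously, so non-agreement is open only within the fibre
  -- relation.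
  obtain ⟨r, hrT, hrU, hrV⟩ := hT {r | LocallyAgree f ω r}
    {r | ∀ᶠ r' : ℂ × ℂ in 𝓝 r, f.eval r'.1 = f.eval r'.2 → ¬ LocallyAgree f ω r'}
    (isOpen_iff_eventually.2 fun r hr => eventually_eventually_nhds.2 hr)
    (isOpen_iff_eventually.2 fun r hr => eventually_eventually_nhds.2 hr)
    (fun r hr => (em (LocallyAgree f ω r)).imp id (hV r hr))
    ⟨p, hp, h⟩ ⟨q, hq, hV q hq hnq⟩
  exact hrV.self_of_nhds (hTf r hrT) hrU

/-! ### Monodromy and simple cycles -/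

theorem derivative_eval_ne_zero_of_mem_regularValues {f : ℂ[X]} {x : ℂ}
    (h : f.eval x ∈ regularValues f) : f.derivative.eval x ≠ 0 :=
  fun h0 => h ⟨x, h0, rfl⟩

theorem monodromy_injective {E X : Type*} [TopologicalSpace E] [TopologicalSpace X] {p : E → X}
    (cov : IsCoveringMap p) {a b : X} (γ : Path.Homotopic.Quotient a b) :
    Function.Injective (cov.monodromy γ) := by
  refine Function.LeftInverse.injective (g := cov.monodromy γ.symm) fun e => ?_
  rw [← cov.monodromy_trans_apply, Path.Homotopic.Quotient.trans_symm, cov.monodromy_refl, id]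

/-- The lifts of a path from x and y trace a connected set of common-fibre pairs. -/
theorem locallyAgree_monodromy_iff (f ω : ℂ[X]) {a b : regularValues f}
    (γ : Path.Homotopic.Quotient a b)
    (x y : ((regularValues f).restrictPreimage fun x => f.eval x) ⁻¹' {a}) :
    LocallyAgree f ω (((isCoveringMap_regular f).monodromy γ x).1.1,
      ((isCoveringMap_regular f).monodromy γ y).1.1) ↔ LocallyAgree f ω (x.1.1, y.1.1) := by
  obtain ⟨γ⟩ := γ
  have cov := isCoveringMap_regular f
  have hx : γ 0 = ((regularValues f).restrictPreimage fun x => f.eval x) x.1 :=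
    γ.source.trans x.2.symm
  have hy : γ 0 = ((regularValues f).restrictPreimage fun x => f.eval x) y.1 :=
    γ.source.trans y.2.symm
  set Γx := cov.liftPath γ x.1 hx with hΓx
  set Γy := cov.liftPath γ y.1 hy with hΓy
  have lx : ∀ t, f.eval (Γx t).1 = γ t := fun t =>
    congrArg Subtype.val (congrFun (cov.liftPath_lifts γ x.1 hx) t)
  have ly : ∀ t, f.eval (Γy t).1 = γ t := fun t =>
    congrArg Subtype.val (congrFun (cov.liftPath_lifts γ y.1 hy) t)
  have hT : IsPreconnected (Set.range fun t => ((Γx t).1, (Γy t).1)) :=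
    isPreconnected_range (by fun_prop)
  have hTf : ∀ p ∈ Set.range fun t => ((Γx t).1, (Γy t).1), f.eval p.1 = f.eval p.2 := by
    rintro _ ⟨t, rfl⟩
    exact (lx t).trans (ly t).symm
  have hTd : ∀ p ∈ Set.range fun t => ((Γx t).1, (Γy t).1), f.derivative.eval p.2 ≠ 0 := by
    rintro _ ⟨t, rfl⟩
    exact derivative_eval_ne_zero_of_mem_regularValues (Γy t).2
  have h0 : (x.1.1, y.1.1) ∈ Set.range fun t => ((Γx t).1, (Γy t).1) :=
    ⟨0, by simp only [hΓx, hΓy, cov.liftPath_zero]⟩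
  exact ⟨fun h => h.of_isPreconnected hT hTf hTd ⟨1, rfl⟩ h0,
    fun h => h.of_isPreconnected hT hTf hTd h0 ⟨1, rfl⟩⟩

theorem pointDiff_inj {M : Type} {x y x' y' : M} (hxy : x ≠ y)
    (h : pointDiff x y = pointDiff x' y') : x = x' ∧ y = y' := by
  classical
  have h' := congrArg Subtype.val h
  have h₁ := DFunLike.congr_fun h' x
  have h₂ := DFunLike.congr_fun h' y
  simp only [pointDiff, Finsupp.coe_sub, Pi.sub_apply, Finsupp.single_apply, hxy, hxy.symm,
    if_true, if_false] at h₁ h₂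
  constructor
  · by_contra hne
    rw [if_neg (Ne.symm hne)] at h₁
    split_ifs at h₁ <;> simp at h₁
  · by_contra hne
    rw [if_neg (Ne.symm hne)] at h₂
    split_ifs at h₂ <;> simp at h₂

theorem permCycle_pointDiff {M : Type} (σ : Equiv.Perm M) (x y : M) :
    permCycle σ (pointDiff x y) = pointDiff (σ x) (σ y) := by
  refine Subtype.ext (Finsupp.ext fun z => ?_)
  classical
  simp [permCycle, pointDiff, Finsupp.equivMapDomain_apply, Finsupp.single_apply,
    Equiv.eq_symm_apply]

theorem cycleIntegral_pointDiff {f : ℂ[X]} {t : ℂ} (ω : ℂ[X]) (x y : Fiber f t) :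
    cycleIntegral ω (pointDiff x y) = ω.eval (x : ℂ) - ω.eval (y : ℂ) := by
  simp only [cycleIntegral, pointDiff]
  rw [Finsupp.sum_sub_index (by intros; push_cast; ring)]
  simp

/-- If the monodromy group is transitive on simple cycles and `ω` locally agrees on one pair of
distinct points in a regular fibre, then `ω` is a polynomial in `f`. -/
theorem exists_eq_comp_of_monodromyIrreducible {f : ℂ[X]} (hf : 0 < f.natDegree) (ω : ℂ[X])
    {b : regularValues f} (hb : MonodromyIrreducible f b) {t : ℂ} (ht : t ∈ regularValues f)
    {x y : ℂ} (hx : f.eval x = t) (hy : f.eval y = t) (hxy : x ≠ y)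
    (h : LocallyAgree f ω (x, y)) : ∃ p : ℂ[X], ω = p.comp f := by
  have cov := isCoveringMap_regular f
  have hpc : IsPathConnected (regularValues f) :=
    (finite_criticalValues hf).countable.isPathConnected_compl_of_one_lt_rank
      (by simp [Complex.rank_real_complex])
  have : PathConnectedSpace (regularValues f) := isPathConnected_iff_pathConnectedSpace.1 hpc
  let pt : ∀ (s : regularValues f) (z : ℂ), f.eval z = s →
      ((regularValues f).restrictPreimage fun x => f.eval x) ⁻¹' {s} :=
    fun s z hz => (fiberEquiv f s).symm ⟨z, hz⟩
  let path : ∀ s : regularValues f, Path.Homotopic.Quotient s b :=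
    fun s => .mk (PathConnectedSpace.somePath s b)
  let x₁ := cov.monodromy (path ⟨t, ht⟩) (pt ⟨t, ht⟩ x hx)
  let y₁ := cov.monodromy (path ⟨t, ht⟩) (pt ⟨t, ht⟩ y hy)
  have h₁ : LocallyAgree f ω (x₁.1.1, y₁.1.1) := (locallyAgree_monodromy_iff f ω _ _ _).2 h
  have hne₁ : x₁ ≠ y₁ := fun he => hxy <|
    congrArg (fun e => e.1.1) (monodromy_injective cov _ he)
  have hfib : ∀ u v : ((regularValues f).restrictPreimage fun x => f.eval x) ⁻¹' {b},
      u ≠ v → LocallyAgree f ω (u.1.1, v.1.1) := by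
    intro u v huv
    obtain ⟨σ, ⟨γ, rfl⟩, hσ⟩ := hb _ ⟨_, _, (fiberEquiv f b).injective.ne hne₁, rfl⟩ _
      ⟨_, _, (fiberEquiv f b).injective.ne huv, rfl⟩
    rw [permCycle_pointDiff] at hσ
    have hσ := pointDiff_inj ((Equiv.injective _).ne ((fiberEquiv f b).injective.ne hne₁)) hσ
    have hu : cov.monodromy γ x₁ = u := (fiberEquiv f b).injective hσ.1
    have hv : cov.monodromy γ y₁ = v := (fiberEquiv f b).injective hσ.2
    rw [← hu, ← hv]
    exact (locallyAgree_monodromy_iff f ω _ _ _).2 h₁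
  refine exists_eq_comp_of_constant_on_fibers hf ω _ (finite_criticalValues hf) fun u v huv hu => ?_
  by_cases he : u = v
  · rw [he]
  · have hloc := (locallyAgree_monodromy_iff f ω (path ⟨_, hu⟩) (pt ⟨_, hu⟩ u rfl)
      (pt ⟨_, hu⟩ v huv.symm)).1 (hfib _ _ fun h' => he <|
        congrArg (fun e => e.1.1) (monodromy_injective cov _ h'))
    exact hloc.eval_eq huv

/-! ### The main theorem -/

theorem theorem4 (f ω : ℂ[X]) (D : Set ℂ) (hDreg : D ⊆ regularValues f)
    (hDconn : IsPreconnected D) (hDnt : D.Nontrivial)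
    (γ : ∀ t : ℂ, ReducedH0 (Fiber f t)) (hγ : IsContinuousSimpleFamily f D γ)
    (hI : ∀ t ∈ D, cycleIntegral ω (γ t) = 0) :
    ∃ g : ℂ[X][X],
      (g ≠ 0 ∧ g.natDegree ∣ f.natDegree ∧ g.natDegree < f.natDegree) ∧
      g.eval₂ (compRingHom f) ω = 0 ∧
      ((∃ b : regularValues f, MonodromyIrreducible f b) → ∃ p : ℂ[X], ω = p.comp f) := by
  obtain ⟨x, y, hxc, hyc, hxy⟩ := hγ
  have hx : ∀ t ∈ D, f.eval (x t) = t := fun t ht => (hxy t ht).choose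
  have hy : ∀ t ∈ D, f.eval (y t) = t := fun t ht => (hxy t ht).choose_spec.choose
  have hne : ∀ t ∈ D, x t ≠ y t := fun t ht => (hxy t ht).choose_spec.choose_spec.1
  have hω : ∀ t ∈ D, ω.eval (x t) = ω.eval (y t) := by
    intro t ht
    obtain ⟨h₁, h₂, -, e⟩ := hxy t ht
    have := hI t ht
    rwa [e, cycleIntegral_pointDiff, sub_eq_zero] at this
  have hf : 0 < f.natDegree := by
    obtain ⟨s, hs, t, ht, hst⟩ := hDnt
    by_contra! h0
    rw [eq_C_of_natDegree_le_zero h0] at hx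
    exact hst (by rw [← hx s hs, ← hx t ht, eval_C, eval_C])
  have hDperf : Preperfect D := hDconn.preperfect_of_nontrivial hDnt
  obtain ⟨t, ht⟩ := hDnt.nonempty
  have hmono : (∃ b : regularValues f, MonodromyIrreducible f b) → ∃ p : ℂ[X], ω = p.comp f := by
    rintro ⟨b, hb⟩
    refine exists_eq_comp_of_monodromyIrreducible hf ω hb (hDreg ht) (hx t ht) (hy t ht)
      (hne t ht) ?_
    refine (locallyAgree_or_eventually_ne f ω ((hx t ht).trans (hy t ht).symm)
      (derivative_eval_ne_zero_of_mem_regularValues (by rw [hy t ht]; exact hDreg ht))).resolve_right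
      fun hev => ?_
    -- Isolated agreement is impossible: the pairs (x(s), y(s)) agree, tend to (x(t), y(t)), and
    -- differ from it for s ≠ t because f(x(s)) = s.
    have htend : Tendsto (fun s => (x s, y s)) (𝓝[D] t) (𝓝 (x t, y t)) :=
      (hxc t ht).prodMk_nhds (hyc t ht)
    rw [eventually_nhdsWithin_iff] at hev
    have hacc := accPt_iff_frequently_nhdsNE.1 (hDperf t ht)
    have hev' := htend.eventually hev
    rw [eventually_nhdsWithin_iff] at hev'
    obtain ⟨s, hsD, hs, hst⟩ := (hacc.and_eventually
      ((hev'.filter_mono nhdsWithin_le_nhds).and self_mem_nhdsWithin)).exists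
    refine hs hsD (fun he => hst ?_) ((hx s hsD).trans (hy s hsD).symm) (hω s hsD)
    have he : (x s, y s) = (x t, y t) := he
    have hex : x s = x t := congrArg Prod.fst he
    rw [Set.mem_singleton_iff, ← hx s hsD, ← hx t ht, hex]
  rcases exists_annihilator_or_generator hf ω with ⟨g, hg0, hdvd, hlt, hg⟩ | ⟨h, A, hh, hA⟩
  · exact ⟨g, ⟨hg0, hdvd, hlt⟩, hg, hmono⟩
  · have hinf : D.Infinite := hDconn.infinite_of_nontrivial hDnt
    obtain ⟨s, hsD, hs⟩ := (hinf.sdiff (h.rootSet_finite ℂ)).nonempty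
    have hs : h.eval s ≠ 0 := fun h0 => hs (by rw [mem_rootSet]; exact ⟨hh, by simpa using h0⟩)
    -- On L_s the value ω(z) determines z.
    have key : ∀ z, f.eval z = s → (A.map (evalRingHom s)).eval (ω.eval z) = h.eval s * z := by
      intro z hz
      have e := congrArg (evalRingHom z) hA
      rw [hom_eval₂] at e
      have hc : (evalRingHom z).comp (compRingHom f) = evalRingHom s := by
        refine RingHom.ext fun p => ?_
        simp [hz]
      rw [hc] at e
      rw [eval_map]
      simpa [hz] using e
    refine absurd (mul_left_cancel₀ hs ?_) (hne s hsD)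
    rw [← key _ (hx s hsD), ← key _ (hy s hsD), hω s hsD]
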